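/- Let $$T=\begin{pmatrix}\omega_1&\alpha_1&\beta_1&\gamma\\0&\omega_2&\alpha_2&\beta_2\\0&0&\omega_3&\alpha_3\\0&0&0&\omega_4\end{pmatrix}\in\mathcal M_4(\mathbb C),\qquad |\omega_i|\le 1\ \ (i=1,2,3,4).$$ Then $T$ is a contraction for the Euclidean operator norm on $\mathbb C^4$ (that is, $\|T\|\le 1$) if and only if one of the following five systems of conditions holds. 1. $|\omega_2|<1$ and $|\omega_3|<1$; $|\alpha_i|^2\le(1-|\omega_i|^2)(1-|\omega_{i+1}|^2)$ for $i=1,3$; $|\alpha_2|^2<(1-|\omega_2|^2)(1-|\omega_3|^2)$; for $i=1,2$, $$\left|\beta_i(1-|\omega_{i+1}|^2)+\alpha_i\alpha_{i+1}\overline{\omega_{i+1}}\right|^2\le\left[(1-|\omega_i|^2)(1-|\omega_{i+1}|^2)-|\alpha_i|^2\right]\left[(1-|\omega_{i+1}|^2)(1-|\omega_{i+2}|^2)-|\alpha_{i+1}|^2\right];$$ and $$\begin{aligned}&\Big|\gamma\left[(1-|\omega_2|^2)(1-|\omega_3|^2)-|\alpha_2|^2\right]+\alpha_1\beta_2\o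verline{\omega_2}(1-|\omega_3|^2)+\alpha_3\beta_1\overline{\omega_3}(1-|\omega_2|^2)\\&\qquad+\beta_1\beta_2\overline{\alpha_2}+\alpha_1\alpha_2\alpha_3\overline{\omega_2\omega_3}\Big|^2(1-|\omega_2|^2)(1-|\omega_3|^2)\\&\le\Big[\big((1-|\omega_1|^2)(1-|\omega_2|^2)-|\alpha_1|^2\big)\big((1-|\omega_2|^2)(1-|\omega_3|^2)-|\alpha_2|^2\big)-\big|\alpha_1\alpha_2\overline{\omega_2}+\beta_1(1-|\omega_2|^2)\big|^2\Big]\\&\quad\times\Big[\big((1-|\omega_2|^2)(1-|\omega_3|^2)-|\alpha_2|^2\big)\big((1-|\omega_3|^2)(1-|\omega_4|^2)-|\alpha_3|^2\big)-\big|\alpha_2\alpha_3\overline{\omega_3}+\beta_2(1-|\omega_3|^2)\big|^2\Big].\end{aligned}$$ 2. $|\omega_2|<1$ and $|\omega_3|<1$; $|\alpha_i|^2\le(1-|\omega_i|^2)(1-|\omega_{i+1}|^2)$ for $i=1,3$; $|\alpha_2|^2=(1-|\omega_2|^2)(1-|\omega_3|^2)$; $\displaystyle\beta_i=\frac{-\alpha_i\alpha_{i+1}\overline{\omega_{i+1}}}{1-|\omega_{i+1}|^2}$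 for $i=1,2$; and $$\left|\gamma-\frac{\overline{\omega_2}\,\overline{\omega_3}\,\alpha_1\alpha_2\alpha_3}{(1-|\omega_2|^2)(1-|\omega_3|^2)}\right|^2(1-|\omega_2|^2)(1-|\omega_3|^2)\le\left[(1-|\omega_1|^2)(1-|\omega_2|^2)-|\alpha_1|^2\right]\left[(1-|\omega_3|^2)(1-|\omega_4|^2)-|\alpha_3|^2\right].$$ 3. $|\omega_2|=1$ and $|\omega_3|<1$; $\alpha_1=\alpha_2=0$; $|\alpha_3|^2\le(1-|\omega_3|^2)(1-|\omega_4|^2)$; $|\beta_1|^2\le(1-|\omega_1|^2)(1-|\omega_3|^2)$; $$\left|\beta_2(1-|\omega_3|^2)\right|^2\le\left[(1-|\omega_2|^2)(1-|\omega_3|^2)-|\alpha_2|^2\right]\left[(1-|\omega_3|^2)(1-|\omega_4|^2)-|\alpha_3|^2\right]$$ (that is, $\beta_2=0$); and $$\left|\gamma(1-|\omega_3|^2)+\alpha_3\beta_1\overline{\omega_3}\right|^2\le\left[(1-|\omega_3|^2)(1-|\omega_4|^2)-|\alpha_3|^2\right]\left[(1-|\omega_1|^2)(1-|\omega_3|^2)-|\beta_1|^2\right].$$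 4. $|\omega_3|=1$ and $|\omega_2|<1$; $|\alpha_1|^2\le(1-|\omega_1|^2)(1-|\omega_2|^2)$; $\alpha_2=\alpha_3=0$; $$\left|\beta_1(1-|\omega_2|^2)\right|^2\le\left[(1-|\omega_1|^2)(1-|\omega_2|^2)-|\alpha_1|^2\right]\left[(1-|\omega_2|^2)(1-|\omega_3|^2)-|\alpha_2|^2\right]$$ (that is, $\beta_1=0$); $|\beta_2|^2\le(1-|\omega_2|^2)(1-|\omega_4|^2)$; and $$\left|\gamma(1-|\omega_2|^2)+\alpha_1\beta_2\overline{\omega_2}\right|^2\le\left[(1-|\omega_1|^2)(1-|\omega_2|^2)-|\alpha_1|^2\right]\left[(1-|\omega_2|^2)(1-|\omega_4|^2)-|\beta_2|^2\right].$$ 5. $|\omega_2|=|\omega_3|=1$; $\alpha_1=\alpha_2=\alpha_3=0$; $|\beta_i|^2\le(1-|\omega_i|^2)(1-|\omega_{i+2}|^2)$ for $i=1,2$; and $|\gamma|^2\le(1-|\omega_1|^2)(1-|\omega_4|^2)$. -/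

import Mathlib

open scoped ComplexConjugate

/-!
The matrix `T` is a contraction iff the Hermitian form `|u|² + 2 Re⟨u, T x⟩ + |x|²` on `ℂ⁴ × ℂ⁴` is
positive semidefinite, because minimizing over `u` leaves `|x|² - |T x|²`. In this form all four
variables `u₃, u₄, x₁, x₂` can be minimized out independently: since `T` is upper triangular, they
are not coupled to each other. What remains (`ContractionForm`) is a Hermitian form in
`u₂, x₃, u₁, x₄` whose first two diagonal entries are `1 - |ω₂|²` and `1 - |ω₃|²`, and whose entry
between `u₁` and `x₄` is `γ`.

The five systems are the possible courses of symmetric Gaussian elimination on this form. A positive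
pivot is removed by a Schur complement (`posForm₃_iff_of_pos`, `posForm₄_iff_of_pos`); a zero pivot
forces its whole row to vanish (`posForm₃_iff_of_zero`, `posForm₄_iff_of_zero`). If `|ω₂| < 1`, the
pivot after `1 - |ω₂|²` is `(1 - |ω₂|²)(1 - |ω₃|²) - |α₂|²`, which separates the first system from
the second and, when `|ω₃| = 1`, forces `α₂ = 0`. The elimination ends with a `2 × 2` form in `u₁`
and `x₄`, where `posForm₂_iff` gives the inequality for `γ`; nonnegativity of its diagonal entries,
with the zero-row conditions, says that the upper left and lower right `3 × 3` blocks of `T` are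
contractions.
-/

/-! ### Hermitian forms in a few complex variables -/

/-- Minimization over one complex variable: the minimum of `a|u|² + 2 Re(ū w) + S` is
`S - |w|² / a`, attained at `u = -w / a`. -/
lemma forall_quadratic_nonneg_iff_of_pos {a S : ℝ} (ha : 0 < a) (w : ℂ) :
    (∀ u : ℂ, 0 ≤ a * Complex.normSq u + 2 * (conj u * w).re + S) ↔
      Complex.normSq w ≤ a * S := by
  constructor
  · intro h
    have h1 := h (-(w / a))
    simp only [map_neg, map_div₀, Complex.conj_ofReal, Complex.normSq_neg, Complex.normSq_ofReal,
      neg_mul, Complex.neg_re, div_mul_eq_mul_div, ← Complex.normSq_eq_conj_mul_self,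
      ← Complex.ofReal_div, Complex.ofReal_re] at h1
    have h2 : a * (a * (Complex.normSq w / (a * a)) + 2 * -(Complex.normSq w / a) + S)
        = a * S - Complex.normSq w := by field_simp; ring
    have h3 := mul_nonneg ha.le h1
    linarith
  · intro h u
    have h1 : a * (a * Complex.normSq u + 2 * (conj u * w).re + S)
        = Complex.normSq (a * u + w) + (a * S - Complex.normSq w) := by
      simp [Complex.normSq_apply]; ring
    have h2 := Complex.normSq_nonneg (a * u + w)
    refine nonneg_of_mul_nonneg_right (a := a) ?_ ha
    linarith

/-- With vanishing leading coefficient, a lower bound forces the linear term to vanish. -/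
lemma forall_quadratic_nonneg_iff_of_zero (w : ℂ) (S : ℝ) :
    (∀ u : ℂ, 0 ≤ 2 * (conj u * w).re + S) ↔ w = 0 ∧ 0 ≤ S := by
  constructor
  · intro h
    have hS : 0 ≤ S := by simpa using h 0
    refine ⟨?_, hS⟩
    by_contra hw
    have hn := Complex.normSq_pos.mpr hw
    have h1 := h (-((S + 1) / Complex.normSq w : ℝ) * w)
    have h2 : (conj (-((S + 1) / Complex.normSq w : ℝ) * w) * w).re = -(S + 1) := by
      rw [map_mul, mul_assoc, ← Complex.normSq_eq_conj_mul_self, map_neg, Complex.conj_ofReal,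
        ← Complex.ofReal_neg, ← Complex.ofReal_mul, Complex.ofReal_re]
      field_simp
    linarith
  · rintro ⟨rfl, hS⟩ u
    simpa using hS

/-- Positive semidefiniteness of the Hermitian form on `ℂ²` with real diagonal `a₁, a₂` and
off-diagonal entry `b`; only the entries above the diagonal are recorded. -/
def PosForm₂ (a₁ a₂ : ℝ) (b : ℂ) : Prop :=
  ∀ x y : ℂ, 0 ≤ a₁ * Complex.normSq x + a₂ * Complex.normSq y + 2 * (conj x * b * y).re

/-- Positive semidefiniteness of the Hermitian form on `ℂ³` with real diagonal `aᵢ` and entries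
`bᵢⱼ` above the diagonal. -/
def PosForm₃ (a₁ a₂ a₃ : ℝ) (b₁₂ b₁₃ b₂₃ : ℂ) : Prop :=
  ∀ x y z : ℂ, 0 ≤ a₁ * Complex.normSq x + a₂ * Complex.normSq y + a₃ * Complex.normSq z +
    2 * (conj x * b₁₂ * y + conj x * b₁₃ * z + conj y * b₂₃ * z).re

/-- Positive semidefiniteness of the Hermitian form on `ℂ⁴` with real diagonal `aᵢ` and entries
`bᵢⱼ` above the diagonal. -/
def PosForm₄ (a₁ a₂ a₃ a₄ : ℝ) (b₁₂ b₁₃ b₁₄ b₂₃ b₂₄ b₃₄ : ℂ) : Prop :=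
  ∀ x y z w : ℂ, 0 ≤ a₁ * Complex.normSq x + a₂ * Complex.normSq y + a₃ * Complex.normSq z +
    a₄ * Complex.normSq w + 2 * (conj x * b₁₂ * y + conj x * b₁₃ * z + conj x * b₁₄ * w +
      conj y * b₂₃ * z + conj y * b₂₄ * w + conj z * b₃₄ * w).re

lemma posForm₂_iff (a₁ a₂ : ℝ) (b : ℂ) :
    PosForm₂ a₁ a₂ b ↔ 0 ≤ a₁ ∧ 0 ≤ a₂ ∧ ‖b‖ ^ 2 ≤ a₁ * a₂ := by
  rw [← Complex.normSq_eq_norm_sq]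
  have key : PosForm₂ a₁ a₂ b ↔ ∀ y x : ℂ, 0 ≤ a₁ * Complex.normSq x + 2 * (conj x * (b * y)).re +
      a₂ * Complex.normSq y := by
    rw [PosForm₂, forall_comm]
    refine forall₂_congr fun y x => ?_
    rw [mul_assoc, add_right_comm]
  constructor
  · intro h
    have h₁ : 0 ≤ a₁ := by simpa using h 1 0
    have h₂ : 0 ≤ a₂ := by simpa using h 0 1
    refine ⟨h₁, h₂, ?_⟩
    rw [key] at h
    rcases h₁.eq_or_lt with rfl | h₁
    · have := ((forall_quadratic_nonneg_iff_of_zero (b * 1) _).1 (by simpa using h 1)).1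
      simp_all
    · have := (forall_quadratic_nonneg_iff_of_pos h₁ _).1 (h 1)
      simpa using this
  · rintro ⟨h₁, h₂, h⟩
    rw [key]
    intro y
    rcases h₁.eq_or_lt with rfl | h₁
    · have hb : b = 0 := by
        rw [← Complex.normSq_eq_zero]
        exact le_antisymm (by simpa using h) (Complex.normSq_nonneg _)
      intro x
      have := mul_nonneg h₂ (Complex.normSq_nonneg y)
      simpa [hb] using this
    · rw [forall_quadratic_nonneg_iff_of_pos h₁, Complex.normSq_mul, ← mul_assoc]
      exact mul_le_mul_of_nonneg_right h (Complex.normSq_nonneg y)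

lemma PosForm₃.nonneg_fst {a₁ a₂ a₃ : ℝ} {b₁₂ b₁₃ b₂₃ : ℂ}
    (h : PosForm₃ a₁ a₂ a₃ b₁₂ b₁₃ b₂₃) : 0 ≤ a₁ := by
  simpa using h 1 0 0

/-- Schur complement of a positive first pivot, scaled by that pivot to avoid division. -/
lemma posForm₃_iff_of_pos {a₁ : ℝ} (h : 0 < a₁) (a₂ a₃ : ℝ) (b₁₂ b₁₃ b₂₃ : ℂ) :
    PosForm₃ a₁ a₂ a₃ b₁₂ b₁₃ b₂₃ ↔
      PosForm₂ (a₁ * a₂ - ‖b₁₂‖ ^ 2) (a₁ * a₃ - ‖b₁₃‖ ^ 2) (a₁ * b₂₃ - conj b₁₂ * b₁₃) := by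
  simp only [← Complex.normSq_eq_norm_sq]
  calc _ ↔ ∀ y z x : ℂ, 0 ≤ a₁ * Complex.normSq x + 2 * (conj x * (b₁₂ * y + b₁₃ * z)).re +
          (a₂ * Complex.normSq y + a₃ * Complex.normSq z + 2 * (conj y * b₂₃ * z).re) := by
        constructor
        · intro H y z x; convert H x y z using 1; simp only [Complex.add_re, mul_add, ← mul_assoc]; ring
        · intro H x y z; convert H y z x using 1; simp only [Complex.add_re, mul_add, ← mul_assoc]; ring
    _ ↔ _ := by
        refine forall₂_congr fun y z => ?_
        rw [forall_quadratic_nonneg_iff_of_pos h, ← sub_nonneg]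
        apply iff_of_eq
        congr 1
        simp [Complex.normSq_apply]
        ring

/-- A zero pivot of a positive semidefinite form has a zero row. -/
lemma posForm₃_iff_of_zero (a₂ a₃ : ℝ) (b₁₂ b₁₃ b₂₃ : ℂ) :
    PosForm₃ 0 a₂ a₃ b₁₂ b₁₃ b₂₃ ↔ b₁₂ = 0 ∧ b₁₃ = 0 ∧ PosForm₂ a₂ a₃ b₂₃ := by
  constructor
  · intro H
    have key (y z : ℂ) := (forall_quadratic_nonneg_iff_of_zero (b₁₂ * y + b₁₃ * z)
      (a₂ * Complex.normSq y + a₃ * Complex.normSq z + 2 * (conj y * b₂₃ * z).re)).1 fun x => by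
        convert H x y z using 1; simp only [Complex.add_re, mul_add, ← mul_assoc]; ring
    refine ⟨by simpa using (key 1 0).1, by simpa using (key 0 1).1, fun y z => (key y z).2⟩
  · rintro ⟨rfl, rfl, H⟩ x y z
    simpa using H y z

/-- Schur complement of a positive first pivot, scaled by that pivot to avoid division. -/
lemma posForm₄_iff_of_pos {a₁ : ℝ} (h : 0 < a₁) (a₂ a₃ a₄ : ℝ) (b₁₂ b₁₃ b₁₄ b₂₃ b₂₄ b₃₄ : ℂ) :
    PosForm₄ a₁ a₂ a₃ a₄ b₁₂ b₁₃ b₁₄ b₂₃ b₂₄ b₃₄ ↔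
      PosForm₃ (a₁ * a₂ - ‖b₁₂‖ ^ 2) (a₁ * a₃ - ‖b₁₃‖ ^ 2) (a₁ * a₄ - ‖b₁₄‖ ^ 2)
        (a₁ * b₂₃ - conj b₁₂ * b₁₃) (a₁ * b₂₄ - conj b₁₂ * b₁₄) (a₁ * b₃₄ - conj b₁₃ * b₁₄) := by
  simp only [← Complex.normSq_eq_norm_sq]
  calc _ ↔ ∀ y z w x : ℂ, 0 ≤ a₁ * Complex.normSq x +
          2 * (conj x * (b₁₂ * y + b₁₃ * z + b₁₄ * w)).re +
          (a₂ * Complex.normSq y + a₃ * Complex.normSq z + a₄ * Complex.normSq w +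
            2 * (conj y * b₂₃ * z + conj y * b₂₄ * w + conj z * b₃₄ * w).re) := by
        constructor
        · intro H y z w x; convert H x y z w using 1
          simp only [Complex.add_re, mul_add, ← mul_assoc]; ring
        · intro H x y z w; convert H y z w x using 1
          simp only [Complex.add_re, mul_add, ← mul_assoc]; ring
    _ ↔ _ := by
        refine forall₃_congr fun y z w => ?_
        rw [forall_quadratic_nonneg_iff_of_pos h, ← sub_nonneg]
        apply iff_of_eq
        congr 1
        simp [Complex.normSq_apply]
        ring

/-- A zero pivot of a positive semidefinite form has a zero row. -/
lemma posForm₄_iff_of_zero (a₂ a₃ a₄ : ℝ) (b₁₂ b₁₃ b₁₄ b₂₃ b₂₄ b₃₄ : ℂ) :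
    PosForm₄ 0 a₂ a₃ a₄ b₁₂ b₁₃ b₁₄ b₂₃ b₂₄ b₃₄ ↔
      b₁₂ = 0 ∧ b₁₃ = 0 ∧ b₁₄ = 0 ∧ PosForm₃ a₂ a₃ a₄ b₂₃ b₂₄ b₃₄ := by
  constructor
  · intro H
    have key (y z w : ℂ) := (forall_quadratic_nonneg_iff_of_zero (b₁₂ * y + b₁₃ * z + b₁₄ * w)
      (a₂ * Complex.normSq y + a₃ * Complex.normSq z + a₄ * Complex.normSq w +
        2 * (conj y * b₂₃ * z + conj y * b₂₄ * w + conj z * b₃₄ * w).re)).1 fun x => by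
        convert H x y z w using 1; simp only [Complex.add_re, mul_add, ← mul_assoc]; ring
    exact ⟨by simpa using (key 1 0 0).1, by simpa using (key 0 1 0).1, by simpa using (key 0 0 1).1,
      fun y z w => (key y z w).2⟩
  · rintro ⟨rfl, rfl, rfl, H⟩ x y z w
    simpa using H y z w

/-! ### Reduction of the norm bound to a Hermitian form -/

lemma norm_upperTriangular_le_one_iff (ω₁ ω₂ ω₃ ω₄ α₁ α₂ α₃ β₁ β₂ γ : ℂ) :
    ‖Matrix.toEuclideanCLM (n := Fin 4) (𝕜 := ℂ)
        !![ω₁, α₁, β₁, γ;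
           0, ω₂, α₂, β₂;
           0, 0, ω₃, α₃;
           0, 0, 0, ω₄]‖ ≤ 1 ↔
    ∀ x₁ x₂ x₃ x₄ : ℂ,
      Complex.normSq (ω₁ * x₁ + α₁ * x₂ + β₁ * x₃ + γ * x₄) +
        Complex.normSq (ω₂ * x₂ + α₂ * x₃ + β₂ * x₄) +
        Complex.normSq (ω₃ * x₃ + α₃ * x₄) + Complex.normSq (ω₄ * x₄) ≤
      Complex.normSq x₁ + Complex.normSq x₂ + Complex.normSq x₃ + Complex.normSq x₄ := by
  rw [ContinuousLinearMap.opNorm_le_iff zero_le_one]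
  simp only [one_mul]
  constructor
  · intro h x₁ x₂ x₃ x₄
    have h1 := pow_le_pow_left₀ (norm_nonneg _) (h (WithLp.toLp 2 ![x₁, x₂, x₃, x₄])) 2
    rw [EuclideanSpace.norm_sq_eq, EuclideanSpace.norm_sq_eq] at h1
    simpa [Fin.sum_univ_four, Matrix.toEuclideanCLM_toLp, Matrix.mulVec, dotProduct,
      Complex.normSq_eq_norm_sq, mul_pow, mul_comm, add_assoc] using h1
  · intro h x
    obtain ⟨v, rfl⟩ := (WithLp.toLp_surjective 2) x
    refine le_of_sq_le_sq ?_ (norm_nonneg _)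
    rw [EuclideanSpace.norm_sq_eq, EuclideanSpace.norm_sq_eq]
    have := h (v 0) (v 1) (v 2) (v 3)
    simpa [Fin.sum_univ_four, Matrix.toEuclideanCLM_toLp, Matrix.mulVec, dotProduct,
      Complex.normSq_eq_norm_sq, mul_pow] using this

/-- Rescaling that passes between the Schur-complement inequality for `γ` and its form symmetric
in the two inner diagonal entries. -/
lemma sq_mul_le_mul_div_mul_iff {s t x y z : ℝ} (hs : 0 < s) (ht : 0 < t) :
    (s * x) ^ 2 ≤ y * (s / t * z) ↔ x ^ 2 * s * t ≤ y * z := by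
  rw [← mul_le_mul_iff_of_pos_left (div_pos hs ht) (b := x ^ 2 * s * t)]
  apply iff_of_eq
  congr 1 <;> field_simp

/-- Positive semidefiniteness of the Hermitian form that remains when the variables `u₃, u₄, x₁, x₂`
are minimized out of `|u|² + 2 Re⟨u, T x⟩ + |x|²`. The remaining variables are ordered
`u₂, x₃, u₁, x₄`, so that the pivots `1 - |ω₂|²` and `1 - |ω₃|²` come first. -/
def ContractionForm (ω₁ ω₂ ω₃ ω₄ α₁ α₂ α₃ β₁ β₂ γ : ℂ) : Prop :=
  PosForm₄ (1 - ‖ω₂‖ ^ 2) (1 - ‖ω₃‖ ^ 2) (1 - ‖ω₁‖ ^ 2 - ‖α₁‖ ^ 2) (1 - ‖ω₄‖ ^ 2 - ‖α₃‖ ^ 2)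
    α₂ (-(conj α₁ * ω₂)) β₂ (conj β₁) (-(conj ω₃ * α₃)) γ

/-- The variables `u₁, u₂` are introduced to linearize `|(T x)₁|²` and `|(T x)₂|²`, after which
`x₁` and `x₂` are minimized out; all four steps concern a variable with leading coefficient `1`. -/
lemma norm_upperTriangular_le_one_iff_contractionForm (ω₁ ω₂ ω₃ ω₄ α₁ α₂ α₃ β₁ β₂ γ : ℂ) :
    ‖Matrix.toEuclideanCLM (n := Fin 4) (𝕜 := ℂ)
        !![ω₁, α₁, β₁, γ;
           0, ω₂, α₂, β₂;
           0, 0, ω₃, α₃;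
           0, 0, 0, ω₄]‖ ≤ 1 ↔
    ContractionForm ω₁ ω₂ ω₃ ω₄ α₁ α₂ α₃ β₁ β₂ γ := by
  rw [norm_upperTriangular_le_one_iff, ContractionForm]
  have monic (w : ℂ) (S : ℝ) := forall_quadratic_nonneg_iff_of_pos (S := S) one_pos w
  simp only [one_mul] at monic
  simp only [← Complex.normSq_eq_norm_sq]
  calc _ ↔ ∀ u₂ x₃ u₁ x₄ x₂ x₁ : ℂ, 0 ≤ Complex.normSq x₁ + 2 * (conj x₁ * (conj ω₁ * u₁)).re +
          (Complex.normSq x₂ + 2 * (conj x₂ * (conj α₁ * u₁ + conj ω₂ * u₂)).re +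
            (Complex.normSq u₁ + Complex.normSq u₂ + Complex.normSq x₃ + Complex.normSq x₄ +
              2 * (conj u₁ * (β₁ * x₃ + γ * x₄) + conj u₂ * (α₂ * x₃ + β₂ * x₄)).re -
              Complex.normSq (ω₃ * x₃ + α₃ * x₄) - Complex.normSq (ω₄ * x₄))) := by
        have key (x₁ x₂ x₃ x₄ : ℂ) :
            (Complex.normSq (ω₁ * x₁ + α₁ * x₂ + β₁ * x₃ + γ * x₄) +
              Complex.normSq (ω₂ * x₂ + α₂ * x₃ + β₂ * x₄) +
              Complex.normSq (ω₃ * x₃ + α₃ * x₄) + Complex.normSq (ω₄ * x₄) ≤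
            Complex.normSq x₁ + Complex.normSq x₂ + Complex.normSq x₃ + Complex.normSq x₄) ↔
            ∀ u₂ u₁ : ℂ, 0 ≤ Complex.normSq u₁ +
              2 * (conj u₁ * (ω₁ * x₁ + α₁ * x₂ + β₁ * x₃ + γ * x₄)).re +
              (Complex.normSq u₂ + 2 * (conj u₂ * (ω₂ * x₂ + α₂ * x₃ + β₂ * x₄)).re +
              (Complex.normSq x₁ + Complex.normSq x₂ + Complex.normSq x₃ + Complex.normSq x₄ -
              Complex.normSq (ω₃ * x₃ + α₃ * x₄) - Complex.normSq (ω₄ * x₄))) := by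
          simp only [monic]
          -- With `u₁` minimized out, the constant term for `u₂` contains `-|(T x)₁|²`.
          have := monic (ω₂ * x₂ + α₂ * x₃ + β₂ * x₄)
            (Complex.normSq x₁ + Complex.normSq x₂ + Complex.normSq x₃ + Complex.normSq x₄ -
              Complex.normSq (ω₃ * x₃ + α₃ * x₄) - Complex.normSq (ω₄ * x₄) -
              Complex.normSq (ω₁ * x₁ + α₁ * x₂ + β₁ * x₃ + γ * x₄))
          rw [← sub_nonneg, show ∀ a b c d e : ℝ, (0 ≤ e - (a + b + c + d) ↔ b ≤ e - c - d - a) from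
            fun a b c d e => ⟨fun h => by linarith, fun h => by linarith⟩, ← this]
          refine forall_congr' fun u => ?_
          constructor <;> intro h <;> linarith
        simp only [key]
        constructor
        · intro H u₂ x₃ u₁ x₄ x₂ x₁
          convert H x₁ x₂ x₃ x₄ u₂ u₁ using 1
          simp [Complex.normSq_apply]
          ring
        · intro H x₁ x₂ x₃ x₄ u₂ u₁
          convert H u₂ x₃ u₁ x₄ x₂ x₁ using 1
          simp [Complex.normSq_apply]
          ring
    _ ↔ ∀ u₂ x₃ u₁ x₄ : ℂ, Complex.normSq (conj α₁ * u₁ + conj ω₂ * u₂) ≤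
            (Complex.normSq u₁ + Complex.normSq u₂ + Complex.normSq x₃ + Complex.normSq x₄ +
              2 * (conj u₁ * (β₁ * x₃ + γ * x₄) + conj u₂ * (α₂ * x₃ + β₂ * x₄)).re -
              Complex.normSq (ω₃ * x₃ + α₃ * x₄) - Complex.normSq (ω₄ * x₄)) -
              Complex.normSq (conj ω₁ * u₁) := by
        refine forall₄_congr fun u₂ x₃ u₁ x₄ => ?_
        rw [← monic]
        refine forall_congr' fun x₂ => ?_
        rw [monic]
        constructor <;> intro h <;> linarith
    _ ↔ _ := by
        refine forall₄_congr fun u₂ x₃ u₁ x₄ => ?_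
        rw [← sub_nonneg]
        apply iff_of_eq
        congr 1
        simp [Complex.normSq_apply]
        ring

/-! ### Elimination according to the vanishing of the pivots -/

lemma contractionForm_iff_of_norm_eq_one_of_norm_eq_one {ω₁ ω₂ ω₃ ω₄ α₁ α₂ α₃ β₁ β₂ γ : ℂ}
    (h₂ : ‖ω₂‖ = 1) (h₃ : ‖ω₃‖ = 1) (h₁ : ‖ω₁‖ ≤ 1) (h₄ : ‖ω₄‖ ≤ 1) :
    ContractionForm ω₁ ω₂ ω₃ ω₄ α₁ α₂ α₃ β₁ β₂ γ ↔
      α₁ = 0 ∧ α₂ = 0 ∧ α₃ = 0 ∧ β₁ = 0 ∧ β₂ = 0 ∧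
        ‖γ‖ ^ 2 ≤ (1 - ‖ω₁‖ ^ 2) * (1 - ‖ω₄‖ ^ 2) := by
  have hω₂ : ω₂ ≠ 0 := norm_ne_zero_iff.1 (by simp [h₂])
  have hω₃ : ω₃ ≠ 0 := norm_ne_zero_iff.1 (by simp [h₃])
  have hs₁ : 0 ≤ 1 - ‖ω₁‖ ^ 2 := sub_nonneg.2 (pow_le_one₀ (norm_nonneg _) h₁)
  have hs₄ : 0 ≤ 1 - ‖ω₄‖ ^ 2 := sub_nonneg.2 (pow_le_one₀ (norm_nonneg _) h₄)
  rw [ContractionForm, h₂, h₃, one_pow, sub_self, posForm₄_iff_of_zero, posForm₃_iff_of_zero,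
    posForm₂_iff]
  simp only [neg_eq_zero, mul_eq_zero, map_eq_zero, hω₂, hω₃, or_false, false_or]
  constructor
  · rintro ⟨rfl, rfl, rfl, rfl, rfl, -, -, h⟩
    simpa using h
  · rintro ⟨rfl, rfl, rfl, rfl, rfl, h⟩
    simpa [hs₁, hs₄] using h

lemma contractionForm_iff_of_norm_eq_one_of_norm_lt_one {ω₁ ω₂ ω₃ ω₄ α₁ α₂ α₃ β₁ β₂ γ : ℂ}
    (h₂ : ‖ω₂‖ = 1) (h₃ : ‖ω₃‖ < 1) :
    ContractionForm ω₁ ω₂ ω₃ ω₄ α₁ α₂ α₃ β₁ β₂ γ ↔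
      α₁ = 0 ∧ α₂ = 0 ∧ β₂ = 0 ∧
        ‖β₁‖ ^ 2 ≤ (1 - ‖ω₁‖ ^ 2) * (1 - ‖ω₃‖ ^ 2) ∧
        ‖α₃‖ ^ 2 ≤ (1 - ‖ω₃‖ ^ 2) * (1 - ‖ω₄‖ ^ 2) ∧
        ‖γ * (1 - (‖ω₃‖ : ℂ) ^ 2) + α₃ * β₁ * conj ω₃‖ ^ 2 ≤
          ((1 - ‖ω₁‖ ^ 2) * (1 - ‖ω₃‖ ^ 2) - ‖β₁‖ ^ 2) *
          ((1 - ‖ω₃‖ ^ 2) * (1 - ‖ω₄‖ ^ 2) - ‖α₃‖ ^ 2) := by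
  have hω₂ : ω₂ ≠ 0 := norm_ne_zero_iff.1 (by simp [h₂])
  have hs₃ : 0 < 1 - ‖ω₃‖ ^ 2 := sub_pos.2 (pow_lt_one₀ (norm_nonneg _) h₃ two_ne_zero)
  rw [ContractionForm, h₂, one_pow, sub_self, posForm₄_iff_of_zero, posForm₃_iff_of_pos hs₃,
    posForm₂_iff]
  simp only [neg_eq_zero, mul_eq_zero, map_eq_zero, hω₂, or_false]
  have e₁ : (1 - ‖ω₃‖ ^ 2) * (1 - ‖ω₄‖ ^ 2 - ‖α₃‖ ^ 2) - ‖-(conj ω₃ * α₃)‖ ^ 2 =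
      (1 - ‖ω₃‖ ^ 2) * (1 - ‖ω₄‖ ^ 2) - ‖α₃‖ ^ 2 := by
    simp only [norm_neg, norm_mul, Complex.norm_conj]; ring
  have e₂ : ((1 - ‖ω₃‖ ^ 2 : ℝ) : ℂ) * γ - conj (conj β₁) * -(conj ω₃ * α₃) =
      γ * (1 - (‖ω₃‖ : ℂ) ^ 2) + α₃ * β₁ * conj ω₃ := by
    push_cast [Complex.conj_conj]; ring
  rw [e₁, e₂, Complex.norm_conj, sub_nonneg, sub_nonneg, mul_comm (1 - ‖ω₃‖ ^ 2) (1 - ‖ω₁‖ ^ 2 - _)]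
  constructor
  · rintro ⟨rfl, rfl, rfl, h⟩
    simpa using h
  · rintro ⟨rfl, rfl, rfl, h⟩
    simpa using h

/-- Elimination of `u₂` when its pivot `1 - |ω₂|²` is positive. The next pivot is the defect
`(1 - |ω₂|²)(1 - |ω₃|²) - |α₂|²` of the central `2 × 2` block. -/
lemma contractionForm_iff_posForm₃ {ω₁ ω₂ ω₃ ω₄ α₁ α₂ α₃ β₁ β₂ γ : ℂ} (h₂ : ‖ω₂‖ < 1) :
    ContractionForm ω₁ ω₂ ω₃ ω₄ α₁ α₂ α₃ β₁ β₂ γ ↔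
      PosForm₃ ((1 - ‖ω₂‖ ^ 2) * (1 - ‖ω₃‖ ^ 2) - ‖α₂‖ ^ 2)
        ((1 - ‖ω₁‖ ^ 2) * (1 - ‖ω₂‖ ^ 2) - ‖α₁‖ ^ 2)
        ((1 - ‖ω₂‖ ^ 2) * (1 - ‖ω₄‖ ^ 2 - ‖α₃‖ ^ 2) - ‖β₂‖ ^ 2)
        (conj (β₁ * (1 - (‖ω₂‖ : ℂ) ^ 2) + α₁ * α₂ * conj ω₂))
        (-((1 - (‖ω₂‖ : ℂ) ^ 2) * α₃ * conj ω₃ + β₂ * conj α₂))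
        (γ * (1 - (‖ω₂‖ : ℂ) ^ 2) + α₁ * β₂ * conj ω₂) := by
  have hs₂ : 0 < 1 - ‖ω₂‖ ^ 2 := sub_pos.2 (pow_lt_one₀ (norm_nonneg _) h₂ two_ne_zero)
  rw [ContractionForm, posForm₄_iff_of_pos hs₂]
  apply iff_of_eq
  congr 1
  · simp only [norm_neg, norm_mul, Complex.norm_conj]; ring
  all_goals
    simp only [map_add, map_mul, map_neg, map_sub, map_one, map_pow, Complex.conj_conj,
      Complex.conj_ofReal, Complex.ofReal_sub, Complex.ofReal_one, Complex.ofReal_pow]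
    ring

lemma contractionForm_iff_of_norm_lt_one_of_norm_eq_one {ω₁ ω₂ ω₃ ω₄ α₁ α₂ α₃ β₁ β₂ γ : ℂ}
    (h₂ : ‖ω₂‖ < 1) (h₃ : ‖ω₃‖ = 1) :
    ContractionForm ω₁ ω₂ ω₃ ω₄ α₁ α₂ α₃ β₁ β₂ γ ↔
      α₂ = 0 ∧ α₃ = 0 ∧ β₁ = 0 ∧
        ‖α₁‖ ^ 2 ≤ (1 - ‖ω₁‖ ^ 2) * (1 - ‖ω₂‖ ^ 2) ∧
        ‖β₂‖ ^ 2 ≤ (1 - ‖ω₂‖ ^ 2) * (1 - ‖ω₄‖ ^ 2) ∧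
        ‖γ * (1 - (‖ω₂‖ : ℂ) ^ 2) + α₁ * β₂ * conj ω₂‖ ^ 2 ≤
          ((1 - ‖ω₁‖ ^ 2) * (1 - ‖ω₂‖ ^ 2) - ‖α₁‖ ^ 2) *
          ((1 - ‖ω₂‖ ^ 2) * (1 - ‖ω₄‖ ^ 2) - ‖β₂‖ ^ 2) := by
  have hω₃ : ω₃ ≠ 0 := norm_ne_zero_iff.1 (by simp [h₃])
  have hs₂ : (1 - (‖ω₂‖ : ℂ) ^ 2) ≠ 0 := by
    exact_mod_cast (sub_pos.2 (pow_lt_one₀ (norm_nonneg _) h₂ two_ne_zero)).ne'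
  rw [contractionForm_iff_posForm₃ h₂, h₃, one_pow, sub_self, mul_zero, zero_sub]
  constructor
  · intro H
    obtain rfl : α₂ = 0 := by
      have := H.nonneg_fst
      rw [← norm_eq_zero, ← sq_eq_zero_iff]
      exact le_antisymm (by linarith) (sq_nonneg _)
    rw [norm_zero, zero_pow two_ne_zero, neg_zero, posForm₃_iff_of_zero] at H
    obtain ⟨hβ₁, hα₃, H⟩ := H
    obtain rfl : β₁ = 0 := by simpa [hs₂] using hβ₁
    obtain rfl : α₃ = 0 := by simpa [hs₂, hω₃] using hα₃
    simpa [posForm₂_iff] using H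
  · rintro ⟨rfl, rfl, rfl, h⟩
    simpa [posForm₃_iff_of_zero, posForm₂_iff] using h

/-- The central block has norm one but diagonal entries inside the open disc: the pivot of `x₃`
vanishes, its row determines `β₁` and `β₂`, and a `2 × 2` form in `u₁, x₄` remains. -/
lemma contractionForm_iff_of_norm_sq_eq {ω₁ ω₂ ω₃ ω₄ α₁ α₂ α₃ β₁ β₂ γ : ℂ}
    (h₂ : ‖ω₂‖ < 1) (h₃ : ‖ω₃‖ < 1) (hα₂ : ‖α₂‖ ^ 2 = (1 - ‖ω₂‖ ^ 2) * (1 - ‖ω₃‖ ^ 2)) :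
    ContractionForm ω₁ ω₂ ω₃ ω₄ α₁ α₂ α₃ β₁ β₂ γ ↔
      β₁ = -(α₁ * α₂ * conj ω₂) / (1 - (‖ω₂‖ : ℂ) ^ 2) ∧
      β₂ = -(α₂ * α₃ * conj ω₃) / (1 - (‖ω₃‖ : ℂ) ^ 2) ∧
      ‖α₁‖ ^ 2 ≤ (1 - ‖ω₁‖ ^ 2) * (1 - ‖ω₂‖ ^ 2) ∧
      ‖α₃‖ ^ 2 ≤ (1 - ‖ω₃‖ ^ 2) * (1 - ‖ω₄‖ ^ 2) ∧
      ‖γ - conj ω₂ * conj ω₃ * α₁ * α₂ * α₃ /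
              ((1 - (‖ω₂‖ : ℂ) ^ 2) * (1 - (‖ω₃‖ : ℂ) ^ 2))‖ ^ 2 *
          (1 - ‖ω₂‖ ^ 2) * (1 - ‖ω₃‖ ^ 2) ≤
        ((1 - ‖ω₁‖ ^ 2) * (1 - ‖ω₂‖ ^ 2) - ‖α₁‖ ^ 2) *
          ((1 - ‖ω₃‖ ^ 2) * (1 - ‖ω₄‖ ^ 2) - ‖α₃‖ ^ 2) := by
  have hs₂ : 0 < 1 - ‖ω₂‖ ^ 2 := sub_pos.2 (pow_lt_one₀ (norm_nonneg _) h₂ two_ne_zero)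
  have hs₃ : 0 < 1 - ‖ω₃‖ ^ 2 := sub_pos.2 (pow_lt_one₀ (norm_nonneg _) h₃ two_ne_zero)
  have hc₂ : (1 - (‖ω₂‖ : ℂ) ^ 2) ≠ 0 := by exact_mod_cast hs₂.ne'
  have hc₃ : (1 - (‖ω₃‖ : ℂ) ^ 2) ≠ 0 := by exact_mod_cast hs₃.ne'
  have hα₂c : α₂ * conj α₂ = (1 - (‖ω₂‖ : ℂ) ^ 2) * (1 - (‖ω₃‖ : ℂ) ^ 2) := by
    rw [Complex.mul_conj']; exact_mod_cast hα₂
  have hα₂0 : α₂ ≠ 0 := by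
    rintro rfl
    exact mul_ne_zero hc₂ hc₃ (by simpa using hα₂c.symm)
  have hβ₁ : conj (β₁ * (1 - (‖ω₂‖ : ℂ) ^ 2) + α₁ * α₂ * conj ω₂) = 0 ↔
      β₁ = -(α₁ * α₂ * conj ω₂) / (1 - (‖ω₂‖ : ℂ) ^ 2) := by
    rw [map_eq_zero, eq_div_iff hc₂, eq_neg_iff_add_eq_zero]
  have hβ₂ : -((1 - (‖ω₂‖ : ℂ) ^ 2) * α₃ * conj ω₃ + β₂ * conj α₂) = 0 ↔
      β₂ = -(α₂ * α₃ * conj ω₃) / (1 - (‖ω₃‖ : ℂ) ^ 2) := by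
    rw [neg_eq_zero, eq_div_iff hc₃, eq_neg_iff_add_eq_zero, ← mul_right_inj' hα₂0,
      ← mul_right_inj' hc₂, mul_zero, mul_zero]
    have : α₂ * ((1 - (‖ω₂‖ : ℂ) ^ 2) * α₃ * conj ω₃ + β₂ * conj α₂) =
      (1 - (‖ω₂‖ : ℂ) ^ 2) * (β₂ * (1 - (‖ω₃‖ : ℂ) ^ 2) + α₂ * α₃ * conj ω₃) := by
      linear_combination β₂ * hα₂c
    rw [this]
    simp [hc₂]
  rw [contractionForm_iff_posForm₃ h₂, sub_eq_zero.2 hα₂.symm, posForm₃_iff_of_zero, hβ₁, hβ₂,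
    posForm₂_iff]
  refine and_congr_right fun e₁ => and_congr_right fun e₂ => ?_
  have n₂ : (1 - ‖ω₂‖ ^ 2) * (1 - ‖ω₄‖ ^ 2 - ‖α₃‖ ^ 2) - ‖β₂‖ ^ 2 =
      (1 - ‖ω₂‖ ^ 2) / (1 - ‖ω₃‖ ^ 2) * ((1 - ‖ω₃‖ ^ 2) * (1 - ‖ω₄‖ ^ 2) - ‖α₃‖ ^ 2) := by
    have : ‖1 - (‖ω₃‖ : ℂ) ^ 2‖ = 1 - ‖ω₃‖ ^ 2 := by
      exact_mod_cast Complex.norm_of_nonneg hs₃.le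
    rw [e₂, norm_div, this, norm_neg, norm_mul, norm_mul, Complex.norm_conj, div_pow, mul_pow,
      mul_pow, hα₂]
    field_simp
    ring
  have c : γ * (1 - (‖ω₂‖ : ℂ) ^ 2) + α₁ * β₂ * conj ω₂ = ((1 - ‖ω₂‖ ^ 2 : ℝ) : ℂ) *
      (γ - conj ω₂ * conj ω₃ * α₁ * α₂ * α₃ /
        ((1 - (‖ω₂‖ : ℂ) ^ 2) * (1 - (‖ω₃‖ : ℂ) ^ 2))) := by
    rw [e₂]; push_cast; field_simp; ring
  rw [n₂, c, norm_mul, Complex.norm_real, Real.norm_of_nonneg hs₂.le, sub_nonneg,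
    mul_nonneg_iff_of_pos_left (div_pos hs₂ hs₃), sub_nonneg]
  exact and_congr_right fun _ => and_congr_right fun _ => sq_mul_le_mul_div_mul_iff hs₂ hs₃

/-- The central block is a strict contraction: both `u₂` and `x₃` are eliminated, and the
remaining `2 × 2` form in `u₁, x₄` has `γ` in its off-diagonal entry only. -/
lemma contractionForm_iff_of_norm_sq_lt {ω₁ ω₂ ω₃ ω₄ α₁ α₂ α₃ β₁ β₂ γ : ℂ}
    (h₂ : ‖ω₂‖ < 1) (h₃ : ‖ω₃‖ < 1) (hα₂ : ‖α₂‖ ^ 2 < (1 - ‖ω₂‖ ^ 2) * (1 - ‖ω₃‖ ^ 2)) :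
    ContractionForm ω₁ ω₂ ω₃ ω₄ α₁ α₂ α₃ β₁ β₂ γ ↔
      ‖β₁ * (1 - (‖ω₂‖ : ℂ) ^ 2) + α₁ * α₂ * conj ω₂‖ ^ 2 ≤
        ((1 - ‖ω₁‖ ^ 2) * (1 - ‖ω₂‖ ^ 2) - ‖α₁‖ ^ 2) *
          ((1 - ‖ω₂‖ ^ 2) * (1 - ‖ω₃‖ ^ 2) - ‖α₂‖ ^ 2) ∧
      ‖β₂ * (1 - (‖ω₃‖ : ℂ) ^ 2) + α₂ * α₃ * conj ω₃‖ ^ 2 ≤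
        ((1 - ‖ω₂‖ ^ 2) * (1 - ‖ω₃‖ ^ 2) - ‖α₂‖ ^ 2) *
          ((1 - ‖ω₃‖ ^ 2) * (1 - ‖ω₄‖ ^ 2) - ‖α₃‖ ^ 2) ∧
      ‖γ * ((1 - (‖ω₂‖ : ℂ) ^ 2) * (1 - (‖ω₃‖ : ℂ) ^ 2) - (‖α₂‖ : ℂ) ^ 2) +
            α₁ * β₂ * conj ω₂ * (1 - (‖ω₃‖ : ℂ) ^ 2) +
            α₃ * β₁ * conj ω₃ * (1 - (‖ω₂‖ : ℂ) ^ 2) +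
            β₁ * β₂ * conj α₂ +
            α₁ * α₂ * α₃ * conj (ω₂ * ω₃)‖ ^ 2 *
          (1 - ‖ω₂‖ ^ 2) * (1 - ‖ω₃‖ ^ 2) ≤
        (((1 - ‖ω₁‖ ^ 2) * (1 - ‖ω₂‖ ^ 2) - ‖α₁‖ ^ 2) *
            ((1 - ‖ω₂‖ ^ 2) * (1 - ‖ω₃‖ ^ 2) - ‖α₂‖ ^ 2) -
          ‖α₁ * α₂ * conj ω₂ + β₁ * (1 - (‖ω₂‖ : ℂ) ^ 2)‖ ^ 2) *
        (((1 - ‖ω₂‖ ^ 2) * (1 - ‖ω₃‖ ^ 2) - ‖α₂‖ ^ 2) *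
            ((1 - ‖ω₃‖ ^ 2) * (1 - ‖ω₄‖ ^ 2) - ‖α₃‖ ^ 2) -
          ‖α₂ * α₃ * conj ω₃ + β₂ * (1 - (‖ω₃‖ : ℂ) ^ 2)‖ ^ 2) := by
  have hs₂ : 0 < 1 - ‖ω₂‖ ^ 2 := sub_pos.2 (pow_lt_one₀ (norm_nonneg _) h₂ two_ne_zero)
  have hs₃ : 0 < 1 - ‖ω₃‖ ^ 2 := sub_pos.2 (pow_lt_one₀ (norm_nonneg _) h₃ two_ne_zero)
  have n₂ : ((1 - ‖ω₂‖ ^ 2) * (1 - ‖ω₃‖ ^ 2) - ‖α₂‖ ^ 2) *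
        ((1 - ‖ω₂‖ ^ 2) * (1 - ‖ω₄‖ ^ 2 - ‖α₃‖ ^ 2) - ‖β₂‖ ^ 2) -
        ‖-((1 - (‖ω₂‖ : ℂ) ^ 2) * α₃ * conj ω₃ + β₂ * conj α₂)‖ ^ 2 =
      (1 - ‖ω₂‖ ^ 2) / (1 - ‖ω₃‖ ^ 2) *
        (((1 - ‖ω₂‖ ^ 2) * (1 - ‖ω₃‖ ^ 2) - ‖α₂‖ ^ 2) *
            ((1 - ‖ω₃‖ ^ 2) * (1 - ‖ω₄‖ ^ 2) - ‖α₃‖ ^ 2) -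
          ‖α₂ * α₃ * conj ω₃ + β₂ * (1 - (‖ω₃‖ : ℂ) ^ 2)‖ ^ 2) := by
    rw [div_mul_eq_mul_div, eq_div_iff hs₃.ne']
    -- After clearing the denominator, a polynomial identity in the entries and their conjugates.
    have hn (z : ℂ) : (‖z‖ : ℂ) ^ 2 = z * conj z := (Complex.mul_conj' z).symm
    apply Complex.ofReal_injective
    push_cast
    simp only [hn, map_add, map_mul, map_neg, map_sub, map_one, Complex.conj_conj]
    ring
  have c : (((1 - ‖ω₂‖ ^ 2) * (1 - ‖ω₃‖ ^ 2) - ‖α₂‖ ^ 2 : ℝ) : ℂ) *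
        (γ * (1 - (‖ω₂‖ : ℂ) ^ 2) + α₁ * β₂ * conj ω₂) -
        conj (conj (β₁ * (1 - (‖ω₂‖ : ℂ) ^ 2) + α₁ * α₂ * conj ω₂)) *
          -((1 - (‖ω₂‖ : ℂ) ^ 2) * α₃ * conj ω₃ + β₂ * conj α₂) =
      ((1 - ‖ω₂‖ ^ 2 : ℝ) : ℂ) *
        (γ * ((1 - (‖ω₂‖ : ℂ) ^ 2) * (1 - (‖ω₃‖ : ℂ) ^ 2) - (‖α₂‖ : ℂ) ^ 2) +
            α₁ * β₂ * conj ω₂ * (1 - (‖ω₃‖ : ℂ) ^ 2) +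
            α₃ * β₁ * conj ω₃ * (1 - (‖ω₂‖ : ℂ) ^ 2) +
            β₁ * β₂ * conj α₂ +
            α₁ * α₂ * α₃ * conj (ω₂ * ω₃)) := by
    have hn : (‖α₂‖ : ℂ) ^ 2 = α₂ * conj α₂ := (Complex.mul_conj' α₂).symm
    rw [Complex.conj_conj]
    push_cast
    rw [hn, map_mul]
    ring
  rw [contractionForm_iff_posForm₃ h₂, posForm₃_iff_of_pos (sub_pos.2 hα₂), posForm₂_iff, n₂, c,
    Complex.norm_conj, norm_mul, Complex.norm_real, Real.norm_of_nonneg hs₂.le,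
    mul_nonneg_iff_of_pos_left (div_pos hs₂ hs₃), sub_nonneg, sub_nonneg,
    mul_comm (_ - ‖α₂‖ ^ 2) (_ - ‖α₁‖ ^ 2), add_comm (β₁ * _), add_comm (β₂ * _)]
  exact and_congr_right fun _ => and_congr_right fun _ => sq_mul_le_mul_div_mul_iff hs₂ hs₃

/-! ### The characterization of contractions -/

theorem theorem1p2 (ω₁ ω₂ ω₃ ω₄ α₁ α₂ α₃ β₁ β₂ γ : ℂ)
    (hω₁ : ‖ω₁‖ ≤ 1) (hω₂ : ‖ω₂‖ ≤ 1) (hω₃ : ‖ω₃‖ ≤ 1) (hω₄ : ‖ω₄‖ ≤ 1) :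
    ‖Matrix.toEuclideanCLM (n := Fin 4) (𝕜 := ℂ)
        !![ω₁, α₁, β₁, γ;
           0, ω₂, α₂, β₂;
           0, 0, ω₃, α₃;
           0, 0, 0, ω₄]‖ ≤ 1 ↔
    -- first system
    (‖ω₂‖ < 1 ∧ ‖ω₃‖ < 1 ∧
      ‖α₁‖ ^ 2 ≤ (1 - ‖ω₁‖ ^ 2) * (1 - ‖ω₂‖ ^ 2) ∧
      ‖α₃‖ ^ 2 ≤ (1 - ‖ω₃‖ ^ 2) * (1 - ‖ω₄‖ ^ 2) ∧
      ‖α₂‖ ^ 2 < (1 - ‖ω₂‖ ^ 2) * (1 - ‖ω₃‖ ^ 2) ∧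
      ‖β₁ * (1 - (‖ω₂‖ : ℂ) ^ 2) + α₁ * α₂ * conj ω₂‖ ^ 2 ≤
        ((1 - ‖ω₁‖ ^ 2) * (1 - ‖ω₂‖ ^ 2) - ‖α₁‖ ^ 2) *
          ((1 - ‖ω₂‖ ^ 2) * (1 - ‖ω₃‖ ^ 2) - ‖α₂‖ ^ 2) ∧
      ‖β₂ * (1 - (‖ω₃‖ : ℂ) ^ 2) + α₂ * α₃ * conj ω₃‖ ^ 2 ≤
        ((1 - ‖ω₂‖ ^ 2) * (1 - ‖ω₃‖ ^ 2) - ‖α₂‖ ^ 2) *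
          ((1 - ‖ω₃‖ ^ 2) * (1 - ‖ω₄‖ ^ 2) - ‖α₃‖ ^ 2) ∧
      ‖γ * ((1 - (‖ω₂‖ : ℂ) ^ 2) * (1 - (‖ω₃‖ : ℂ) ^ 2) - (‖α₂‖ : ℂ) ^ 2) +
            α₁ * β₂ * conj ω₂ * (1 - (‖ω₃‖ : ℂ) ^ 2) +
            α₃ * β₁ * conj ω₃ * (1 - (‖ω₂‖ : ℂ) ^ 2) +
            β₁ * β₂ * conj α₂ +
            α₁ * α₂ * α₃ * conj (ω₂ * ω₃)‖ ^ 2 *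
          (1 - ‖ω₂‖ ^ 2) * (1 - ‖ω₃‖ ^ 2) ≤
        (((1 - ‖ω₁‖ ^ 2) * (1 - ‖ω₂‖ ^ 2) - ‖α₁‖ ^ 2) *
            ((1 - ‖ω₂‖ ^ 2) * (1 - ‖ω₃‖ ^ 2) - ‖α₂‖ ^ 2) -
          ‖α₁ * α₂ * conj ω₂ + β₁ * (1 - (‖ω₂‖ : ℂ) ^ 2)‖ ^ 2) *
        (((1 - ‖ω₂‖ ^ 2) * (1 - ‖ω₃‖ ^ 2) - ‖α₂‖ ^ 2) *
            ((1 - ‖ω₃‖ ^ 2) * (1 - ‖ω₄‖ ^ 2) - ‖α₃‖ ^ 2) -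
          ‖α₂ * α₃ * conj ω₃ + β₂ * (1 - (‖ω₃‖ : ℂ) ^ 2)‖ ^ 2)) ∨
    -- second system
    (‖ω₂‖ < 1 ∧ ‖ω₃‖ < 1 ∧
      ‖α₁‖ ^ 2 ≤ (1 - ‖ω₁‖ ^ 2) * (1 - ‖ω₂‖ ^ 2) ∧
      ‖α₃‖ ^ 2 ≤ (1 - ‖ω₃‖ ^ 2) * (1 - ‖ω₄‖ ^ 2) ∧
      ‖α₂‖ ^ 2 = (1 - ‖ω₂‖ ^ 2) * (1 - ‖ω₃‖ ^ 2) ∧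
      β₁ = -(α₁ * α₂ * conj ω₂) / (1 - (‖ω₂‖ : ℂ) ^ 2) ∧
      β₂ = -(α₂ * α₃ * conj ω₃) / (1 - (‖ω₃‖ : ℂ) ^ 2) ∧
      ‖γ - conj ω₂ * conj ω₃ * α₁ * α₂ * α₃ /
              ((1 - (‖ω₂‖ : ℂ) ^ 2) * (1 - (‖ω₃‖ : ℂ) ^ 2))‖ ^ 2 *
          (1 - ‖ω₂‖ ^ 2) * (1 - ‖ω₃‖ ^ 2) ≤
        ((1 - ‖ω₁‖ ^ 2) * (1 - ‖ω₂‖ ^ 2) - ‖α₁‖ ^ 2) *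
          ((1 - ‖ω₃‖ ^ 2) * (1 - ‖ω₄‖ ^ 2) - ‖α₃‖ ^ 2)) ∨
    -- third system
    (‖ω₂‖ = 1 ∧ ‖ω₃‖ < 1 ∧
      α₁ = 0 ∧ α₂ = 0 ∧
      ‖α₃‖ ^ 2 ≤ (1 - ‖ω₃‖ ^ 2) * (1 - ‖ω₄‖ ^ 2) ∧
      ‖β₁‖ ^ 2 ≤ (1 - ‖ω₁‖ ^ 2) * (1 - ‖ω₃‖ ^ 2) ∧
      ‖β₂ * (1 - (‖ω₃‖ : ℂ) ^ 2)‖ ^ 2 ≤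
        ((1 - ‖ω₂‖ ^ 2) * (1 - ‖ω₃‖ ^ 2) - ‖α₂‖ ^ 2) *
          ((1 - ‖ω₃‖ ^ 2) * (1 - ‖ω₄‖ ^ 2) - ‖α₃‖ ^ 2) ∧
      ‖γ * (1 - (‖ω₃‖ : ℂ) ^ 2) + α₃ * β₁ * conj ω₃‖ ^ 2 ≤
        ((1 - ‖ω₃‖ ^ 2) * (1 - ‖ω₄‖ ^ 2) - ‖α₃‖ ^ 2) *
          ((1 - ‖ω₁‖ ^ 2) * (1 - ‖ω₃‖ ^ 2) - ‖β₁‖ ^ 2)) ∨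
    -- fourth system
    (‖ω₃‖ = 1 ∧ ‖ω₂‖ < 1 ∧
      ‖α₁‖ ^ 2 ≤ (1 - ‖ω₁‖ ^ 2) * (1 - ‖ω₂‖ ^ 2) ∧
      α₂ = 0 ∧ α₃ = 0 ∧
      ‖β₁ * (1 - (‖ω₂‖ : ℂ) ^ 2)‖ ^ 2 ≤
        ((1 - ‖ω₁‖ ^ 2) * (1 - ‖ω₂‖ ^ 2) - ‖α₁‖ ^ 2) *
          ((1 - ‖ω₂‖ ^ 2) * (1 - ‖ω₃‖ ^ 2) - ‖α₂‖ ^ 2) ∧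
      ‖β₂‖ ^ 2 ≤ (1 - ‖ω₂‖ ^ 2) * (1 - ‖ω₄‖ ^ 2) ∧
      ‖γ * (1 - (‖ω₂‖ : ℂ) ^ 2) + α₁ * β₂ * conj ω₂‖ ^ 2 ≤
        ((1 - ‖ω₁‖ ^ 2) * (1 - ‖ω₂‖ ^ 2) - ‖α₁‖ ^ 2) *
          ((1 - ‖ω₂‖ ^ 2) * (1 - ‖ω₄‖ ^ 2) - ‖β₂‖ ^ 2)) ∨
    -- fifth system
    (‖ω₂‖ = 1 ∧ ‖ω₃‖ = 1 ∧
      α₁ = 0 ∧ α₂ = 0 ∧ α₃ = 0 ∧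
      ‖β₁‖ ^ 2 ≤ (1 - ‖ω₁‖ ^ 2) * (1 - ‖ω₃‖ ^ 2) ∧
      ‖β₂‖ ^ 2 ≤ (1 - ‖ω₂‖ ^ 2) * (1 - ‖ω₄‖ ^ 2) ∧
      ‖γ‖ ^ 2 ≤ (1 - ‖ω₁‖ ^ 2) * (1 - ‖ω₄‖ ^ 2)) := by
  rw [norm_upperTriangular_le_one_iff_contractionForm]
  rcases hω₂.lt_or_eq with h₂ | h₂ <;> rcases hω₃.lt_or_eq with h₃ | h₃
  · simp only [h₂, h₃, h₂.ne, h₃.ne, true_and, false_and, or_false]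
    rcases lt_trichotomy (‖α₂‖ ^ 2) ((1 - ‖ω₂‖ ^ 2) * (1 - ‖ω₃‖ ^ 2)) with h | h | h
    · rw [contractionForm_iff_of_norm_sq_lt h₂ h₃ h]
      simp only [h, h.ne, true_and, false_and, and_false, or_false]
      refine ⟨fun ⟨H₁, H₂, H⟩ => ⟨?_, ?_, H₁, H₂, H⟩, fun ⟨_, _, H⟩ => H⟩
      · exact sub_nonneg.1 (nonneg_of_mul_nonneg_left ((sq_nonneg _).trans H₁) (sub_pos.2 h))
      · exact sub_nonneg.1 (nonneg_of_mul_nonneg_right ((sq_nonneg _).trans H₂) (sub_pos.2 h))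
    · rw [contractionForm_iff_of_norm_sq_eq h₂ h₃ h]
      simp only [h, lt_irrefl, true_and, false_and, and_false, false_or]
      tauto
    · simp only [h.not_gt, h.ne', false_and, and_false, or_false, iff_false]
      rw [contractionForm_iff_posForm₃ h₂]
      exact fun H => (sub_neg.2 h).not_ge H.nonneg_fst
  · rw [contractionForm_iff_of_norm_lt_one_of_norm_eq_one h₂ h₃]
    have hs₂ : (1 - (‖ω₂‖ : ℂ) ^ 2) ≠ 0 := by
      exact_mod_cast (sub_pos.2 (pow_lt_one₀ (norm_nonneg _) h₂ two_ne_zero)).ne'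
    simp only [h₂, h₃, h₂.ne, lt_irrefl, true_and, false_and, and_false, or_false, false_or]
    constructor
    · rintro ⟨rfl, rfl, rfl, H₁, H₂, H⟩
      exact ⟨H₁, rfl, rfl, by simp, H₂, H⟩
    · rintro ⟨H₁, rfl, rfl, hβ, H₂, H⟩
      have hβ' : ‖β₁ * (1 - (‖ω₂‖ : ℂ) ^ 2)‖ ^ 2 = 0 := le_antisymm (by simpa using hβ) (sq_nonneg _)
      exact ⟨rfl, rfl, by simpa [hs₂] using hβ', H₁, H₂, H⟩
  · rw [contractionForm_iff_of_norm_eq_one_of_norm_lt_one h₂ h₃]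
    have hs₃ : (1 - (‖ω₃‖ : ℂ) ^ 2) ≠ 0 := by
      exact_mod_cast (sub_pos.2 (pow_lt_one₀ (norm_nonneg _) h₃ two_ne_zero)).ne'
    simp only [h₂, h₃, h₃.ne, lt_irrefl, true_and, false_and, and_false, or_false, false_or]
    constructor
    · rintro ⟨rfl, rfl, rfl, H₁, H₂, H⟩
      exact ⟨rfl, rfl, H₂, H₁, by simp, H.trans_eq (mul_comm _ _)⟩
    · rintro ⟨rfl, rfl, H₂, H₁, hβ, H⟩
      have hβ' : ‖β₂ * (1 - (‖ω₃‖ : ℂ) ^ 2)‖ ^ 2 = 0 := le_antisymm (by simpa using hβ) (sq_nonneg _)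
      exact ⟨rfl, rfl, by simpa [hs₃] using hβ', H₁, H₂, H.trans_eq (mul_comm _ _)⟩
  · rw [contractionForm_iff_of_norm_eq_one_of_norm_eq_one h₂ h₃ hω₁ hω₄]
    simp only [h₂, h₃, lt_irrefl, true_and, false_and, and_false, false_or]
    constructor
    · rintro ⟨rfl, rfl, rfl, rfl, rfl, H⟩
      simpa using H
    · rintro ⟨rfl, rfl, rfl, hβ₁, hβ₂, H⟩
      have hβ₁' : ‖β₁‖ ^ 2 = 0 := le_antisymm (by simpa using hβ₁) (sq_nonneg _)
      have hβ₂' : ‖β₂‖ ^ 2 = 0 := le_antisymm (by simpa using hβ₂) (sq_nonneg _)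
      exact ⟨rfl, rfl, rfl, by simpa using hβ₁', by simpa using hβ₂', H⟩
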